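/- **Setting.** Fix an infinite set of variables. A *probabilistic team* over a finite set $D$ of variables consists of a finite set $X$ of assignments $s\colon D\to A$, with $A$ a finite set of values, and a function $\mathbb X\colon X\to(0,1]$ with $\sum_{s\in X}\mathbb X(s)=1$. For $x\in D$ and $a\in A$ let $|\mathbb X_{x=a}|=\sum_{s\in X,\,s(x)=a}\mathbb X(s)$ and $X(x)=\{s(x)\mid s\in X\}$. The *atoms* are: functional dependencies (FDs) $=(\bar y,\bar z)$, where $\bar y,\bar z$ are finite (possibly empty) tuples of variables; unary marginal identities (UMIs) $x\approx y$; and unary marginal distribution equivalences (UMDEs) $x\approx^* y$, where $x,y$ are variables. Their semantics is: $\mathbb X\models{=}(\bar y,\bar z)$ iff $s(\bar y)=s'(\bar y)$ implies $s(\bar z)=s'(\bar z)$ for all $s,s'\in X$; $\mathbb X\models x\approx y$ iff $|\mathbb X_{x=a}|=|\mathbb X_{y=a}|$ for all $a\in A$; $\mathbb X\models x\approx^*y$ iff the multisets $\{\{|\mathbb X_{x=a}|\mid a\in X(x)\}\}$ and $\{\{|\mathbb X_{y=a}|\mid a\in X(y)\}\}$ are equal. For a set $\Gamma\cup\{\sigma\}$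 of atoms, $\Gamma\models\sigma$ means that every probabilistic team over a finite set containing all variables of $\Gamma\cup\{\sigma\}$ that satisfies all atoms of $\Gamma$ satisfies $\sigma$. A $k$-ary *axiom* is a rule schema $(\sigma_1\text{ and }\dots\text{ and }\sigma_k)\Rightarrow(\delta_1\text{ and }\dots\text{ and }\delta_l)$ with $k$ antecedent atoms, identified with the set of its instances; it is *sound* if $\{\sigma_1,\dots,\sigma_k\}\models\delta_j$ for every $j$ in each instance. An *axiomatization* $\mathcal A$ is a set of axioms; it is *$k$-ary* if each of its axioms is at most $k$-ary. Write $\Gamma\vdash_{\mathcal A}\sigma$ if $\sigma$ can be derived from $\Gamma$ using axioms of $\mathcal A$. $\mathcal A$ is *sound* (resp. *complete*) if for all sets $\Gamma\cup\{\sigma\}$ of atoms such that only finitely many variables appear in $\Gamma$, $\Gamma\vdash_{\mathcal A}\sigma$ implies $\Gamma\models\sigma$ (resp. $\Gamma\models\sigma$ implies $\Gamma\vdash_{\mathcal A}\sigma$). **Theorem.** 1. For every $k\in\mathbb N$, no sound $k$-ary axiomatization is complete (for FD+UMI+UMDE implication). 2. Consequently, no finite sound axiomatization is complete. 3. Let $k\ge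 3$ be odd, let $x_0,\dots,x_k$ be distinct variables, and let $$\Sigma_k=\{{=}(x_0,x_1),\;x_1\approx^*x_2,\;{=}(x_2,x_3),\;\dots,\;{=}(x_{k-1},x_k),\;x_k\approx^*x_0\}.$$ Let $\mathrm{cl}_k(\Sigma_k)$ be the set of all atoms with variables among $x_0,\dots,x_k$ that can be derived from $\Sigma_k$ using the set of all sound axioms that are at most $k$-ary. Let $$\Sigma=\Sigma_k\cup\{x_i\approx x_i\mid 0\le i\le k\}\cup\{x_i\approx^*x_i\mid 0\le i\le k\}\cup\{x_0\approx^*x_k,\;x_{k-1}\approx^*x_{k-2},\;\dots,\;x_2\approx^*x_1\}\cup\Sigma',$$ where $\Sigma'$ is the smallest set of FDs such that (i) ${=}(\bar y,\bar z)\in\Sigma'$ whenever $\mathrm{var}(\bar z)\subseteq\mathrm{var}(\bar y)\subseteq\{x_0,\dots,x_k\}$; (ii) if ${=}(\bar y,\bar z)\in\Sigma'$ and $i\in\{0,2,\dots,k-1\}$, then ${=}(\bar yx_i,\bar zx_{i+1})\in\Sigma'$; (iii) if ${=}(\bar y,\bar z)\in\Sigma'$, $\mathrm{var}(\bar y)=\mathrm{var}(\bar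 y')$ and $\mathrm{var}(\bar z)=\mathrm{var}(\bar z')$, then ${=}(\bar y',\bar z')\in\Sigma'$. (Here $\mathrm{var}(\bar y)$ is the set of variables in $\bar y$.) Then $\mathrm{cl}_k(\Sigma_k)=\Sigma$, and ${=}(x_1,x_0)\notin\Sigma$, although $\Sigma_k\models{=}(x_1,x_0)$. -/

import Mathlib

universe u v

/-- Atoms over a set `V` of variables: functional dependencies `=(x̄, ȳ)` between two (possibly
empty, possibly repetitive) tuples of variables, unary marginal identities `x ≈ y`, and unary
marginal distribution equivalences `x ≈* y`. -/
inductive DepAtom (V : Type u) : Type u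
  | fd (x y : List V) : DepAtom V
  | umi (x y : V) : DepAtom V
  | umde (x y : V) : DepAtom V

namespace DepAtom

/-- The set of variables that appear in an atom. -/
def vars {V : Type u} : DepAtom V → Set V
  | fd x y => {v | v ∈ x ∨ v ∈ y}
  | umi x y => {x, y}
  | umde x y => {x, y}

/-- Renaming the variables of an atom. It is used with the inclusion of a finite set of variables
`D` into `V`, to view an atom over `D` as an atom over `V`. -/
def map {V : Type u} {W : Type v} (f : V → W) : DepAtom V → DepAtom W
  | fd x y => fd (x.map f) (y.map f)
  | umi x y => umi (f x) (f y)
  | umde x y => umde (f x) (f y)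

end DepAtom

/-- A probabilistic team over the set of variables `D` with values in `A`: a finite set `rows` of
assignments `D → A`, each with a weight in `(0, 1]`, the weights adding up to one. The values of
`weight` outside `rows` are never used. -/
structure ProbTeam (D : Type u) (A : Type v) where
  rows : Finset (D → A)
  weight : (D → A) → ℝ
  weight_mem : ∀ s ∈ rows, weight s ∈ Set.Ioc (0 : ℝ) 1
  weight_sum : ∑ s ∈ rows, weight s = 1

namespace ProbTeam

open Classical in
/-- The marginal probability `|𝕏_{x = a}|`. -/
noncomputable def marginal {D : Type u} {A : Type v} (X : ProbTeam D A) (x : D) (a : A) : ℝ :=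
  ∑ s ∈ X.rows with s x = a, X.weight s

open Classical in
/-- The set `X(x)` of the values that the variable `x` takes in the team. -/
noncomputable def values {D : Type u} {A : Type v} (X : ProbTeam D A) (x : D) : Finset A :=
  X.rows.image fun s => s x

/-- The multiset of the marginal probabilities `|𝕏_{x = a}|`, for `a ∈ X(x)`. -/
noncomputable def marginals {D : Type u} {A : Type v} (X : ProbTeam D A) (x : D) : Multiset ℝ :=
  (X.values x).val.map (X.marginal x)

/-- Satisfaction of an atom over `D` by a probabilistic team over `D`. -/
def Sat {D : Type u} {A : Type v} (X : ProbTeam D A) : DepAtom D → Prop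
  | .fd x y => ∀ s ∈ X.rows, ∀ s' ∈ X.rows, x.map s = x.map s' → y.map s = y.map s'
  | .umi x y => ∀ a : A, X.marginal x a = X.marginal y a
  | .umde x y => X.marginals x = X.marginals y

end ProbTeam

/-- Logical implication `Γ ⊨ σ`: whenever `D` is a finite set of variables that contains all
variables of `Γ` and `σ`, and `A` is a finite set of values, each probabilistic team over `D` with
values in `A` that satisfies every atom in `Γ` satisfies `σ`. (Here `σ'` and `τ'` are `σ` and `τ`,
seen as atoms over `D`; they are unique if they exist.) -/
def Entails {V : Type u} (Γ : Set (DepAtom V)) (σ : DepAtom V) : Prop :=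
  ∀ (D : Finset V) (A : Type) [Finite A] (X : ProbTeam D A) (σ' : DepAtom D),
    σ'.map Subtype.val = σ →
    (∀ τ ∈ Γ, ∃ τ' : DepAtom D, τ'.map Subtype.val = τ ∧ X.Sat τ') →
    X.Sat σ'

/-- The variables that appear in a set of atoms. -/
def varsOf {V : Type u} (Γ : Set (DepAtom V)) : Set V :=
  ⋃ τ ∈ Γ, τ.vars

/-- An inference rule, or axiom (schema), of the form
`(σ₁ and … and σₖ) ⟹ (δ₁ and … and δₗ)`, where `k` is `arity`. A rule is given by all its
instances, so that rules with variables for tuples, and with side conditions, are covered. -/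
structure InferenceRule (V : Type u) where
  arity : ℕ
  instances : Set ((Fin arity → DepAtom V) × List (DepAtom V))

/-- A rule is sound if in each instance the antecedent logically implies every consequent. -/
def InferenceRule.IsSound {V : Type u} (R : InferenceRule V) : Prop :=
  ∀ p ∈ R.instances, ∀ δ ∈ p.2, Entails (Set.range p.1) δ

/-- `Derives 𝒜 Γ σ` is `Γ ⊢_𝒜 σ`: the atom `σ` can be derived from `Γ` with the rules in `𝒜`. -/
inductive Derives {V : Type u} (𝒜 : Set (InferenceRule V)) (Γ : Set (DepAtom V)) :
    DepAtom V → Prop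
  | hyp (σ : DepAtom V) (h : σ ∈ Γ) : Derives 𝒜 Γ σ
  | rule (R : InferenceRule V) (hR : R ∈ 𝒜) (p : (Fin R.arity → DepAtom V) × List (DepAtom V))
      (hp : p ∈ R.instances) (hprem : ∀ i, Derives 𝒜 Γ (p.1 i))
      (σ : DepAtom V) (hσ : σ ∈ p.2) : Derives 𝒜 Γ σ

/-- Soundness of an axiomatization, for sets of atoms over finitely many variables. -/
def SoundAxiomatization {V : Type u} (𝒜 : Set (InferenceRule V)) : Prop :=
  ∀ (Γ : Set (DepAtom V)) (σ : DepAtom V), (varsOf Γ).Finite → Derives 𝒜 Γ σ → Entails Γ σ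

/-- Completeness of an axiomatization, for sets of atoms over finitely many variables. -/
def CompleteAxiomatization {V : Type u} (𝒜 : Set (InferenceRule V)) : Prop :=
  ∀ (Γ : Set (DepAtom V)) (σ : DepAtom V), (varsOf Γ).Finite → Entails Γ σ → Derives 𝒜 Γ σ

/-- An axiomatization is `k`-ary if each of its rules is at most `k`-ary. -/
def KAry {V : Type u} (k : ℕ) (𝒜 : Set (InferenceRule V)) : Prop :=
  ∀ R ∈ 𝒜, R.arity ≤ k

/-- The closure `cl_k(Γ)` under `k`-ary implication: all atoms with variables from `Γ` that can be
derived from `Γ` with the set of all sound rules that are at most `k`-ary. -/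
def karyClosure {V : Type u} (k : ℕ) (Γ : Set (DepAtom V)) : Set (DepAtom V) :=
  {σ | σ.vars ⊆ varsOf Γ ∧ Derives {R : InferenceRule V | R.IsSound ∧ R.arity ≤ k} Γ σ}

/-- The cyclic successor on `{0, …, k}`. -/
def cycleSucc (k i : ℕ) : ℕ := if i < k then i + 1 else 0

/-- The antecedent `Σ_k` of the `k`-cycle rule (for odd `k`):
`=(x₀, x₁), x₁ ≈* x₂, =(x₂, x₃), …, =(x_{k-1}, x_k), x_k ≈* x₀`. -/
def cycleAtoms {V : Type u} (k : ℕ) (x : ℕ → V) : Set (DepAtom V) :=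
  {σ | ∃ i ≤ k, Even i ∧ σ = .fd [x i] [x (cycleSucc k i)]} ∪
  {σ | ∃ j ≤ k, Odd j ∧ σ = .umde (x j) (x (cycleSucc k j))}

/-- The inductively defined set `Σ'` of functional dependencies: `CycleFD k x ȳ z̄` says that
`=(ȳ, z̄)` belongs to `Σ'`. -/
inductive CycleFD {V : Type u} (k : ℕ) (x : ℕ → V) : List V → List V → Prop
  | triv (y z : List V) (hz : ∀ v ∈ z, v ∈ y) (hy : ∀ v ∈ y, ∃ i ≤ k, v = x i) : CycleFD k x y z
  | step (y z : List V) (h : CycleFD k x y z) (i : ℕ) (hi : Even i) (hik : i < k) :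
      CycleFD k x (y ++ [x i]) (z ++ [x (i + 1)])
  | congr (y z y' z' : List V) (h : CycleFD k x y z) (hy : ∀ v, v ∈ y ↔ v ∈ y')
      (hz : ∀ v, v ∈ z ↔ v ∈ z') : CycleFD k x y' z'

/-- The explicit set `Σ`: the atoms of `Σ_k`, the reflexive atoms `xᵢ ≈ xᵢ` and `xᵢ ≈* xᵢ`, the
reversed marginal distribution equivalences of `Σ_k`, and `Σ'`. -/
def explicitClosure {V : Type u} (k : ℕ) (x : ℕ → V) : Set (DepAtom V) :=
  cycleAtoms k x ∪
  {σ | ∃ i ≤ k, σ = .umi (x i) (x i)} ∪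
  {σ | ∃ i ≤ k, σ = .umde (x i) (x i)} ∪
  {σ | ∃ j ≤ k, Odd j ∧ σ = .umde (x (cycleSucc k j)) (x j)} ∪
  {σ | ∃ y z, CycleFD k x y z ∧ σ = .fd y z}

/-!
The cycle rule derives `=(x₁, x₀)` from the cycle: along the cycle the number of values of a
variable cannot increase, so all these numbers are equal, and the function that takes the values
of `x₀` onto those of `x₁` is a bijection (`entails_cycle_reverse`). No set of sound rules of arity
at most `k` derives it. The reason is the invariant `InCycleClosure`, the explicit closure together
with the trivial atoms over all variables, which sound rules of arity at most `k` preserve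
(`inCycleClosure_of_derives`).

For the invariance, consider at most `k` atoms of the invariant. None of them does the work of two of
the `k + 1` atoms of the cycle, so the work of some atom, the `c`-th, is missing
(`exists_cycleMissing`). Every consequence of the given atoms is then in the invariant
(`inCycleClosure_of_entails`), because of the following countermodels.

For a family of sets `C l` of variables, the block team has two rows for each `l`, which agree
exactly on `C l`, and it has no other agreements between rows. It satisfies a functional dependency
with nonempty antecedent if all the sets `C l` are closed under it, and it satisfies `a ≈* b` if and
only if `a` and `b` belong to equally many of these sets. As one of the sets take the closure `C₀` of the antecedent of the
functional dependency to be refuted. The cycle, cut open at its `c`-th atom, is a chain, and carries a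
potential `M` that goes up by one along each arrow `x i → x (i + 1)` and is constant along
the links `≈*` (`exists_potential`). Subtracting the indicator function of `C₀` from `M` leaves a
function that does not decrease along arrows, so that its superlevel sets are closed; together with
`C₀` they contain each variable `w` exactly `M w` times. If the missing atom is a functional dependency,
the end `x c` of the chain is split off from the superlevel sets: the sets `{x c}` are
closed under the dependencies that remain, since their antecedents do not consist of `x c` alone.
Finally, `M` separates all pairs of distinct variables that are not linked, so that the same teams
refute the equivalences outside the invariant.
-/

/-! ### Teams induced by the uniform distribution -/

open Classical in
/-- The team induced by the uniform distribution on a finite index type: the assignment `s` gets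
the proportion of the indices `i` with `f i = s`. Distinct indices may give the same assignment. -/
noncomputable def ProbTeam.ofFun {D : Type u} {A : Type v} {ι : Type*} [Fintype ι] [Nonempty ι]
    (f : ι → D → A) : ProbTeam D A where
  rows := Finset.univ.image f
  weight s := ((Finset.univ.filter fun i => f i = s).card : ℝ) / Fintype.card ι
  weight_mem := by
    intro s hs
    obtain ⟨i, -, rfl⟩ := Finset.mem_image.1 hs
    have hpos : (0 : ℝ) < Fintype.card ι := by exact_mod_cast Fintype.card_pos
    refine ⟨div_pos ?_ hpos, (div_le_one hpos).2 ?_⟩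
    · exact_mod_cast Finset.card_pos.2 ⟨i, by simp⟩
    · exact_mod_cast Finset.card_le_univ _
  weight_sum := by
    have hpos : (0 : ℝ) < Fintype.card ι := by exact_mod_cast Fintype.card_pos
    rw [← Finset.sum_div, div_eq_one_iff_eq hpos.ne', ← Nat.cast_sum,
      ← Finset.card_eq_sum_card_image]
    rfl

namespace ProbTeam

section OfFun

variable {D : Type u} {A : Type v} {ι : Type*} [Fintype ι] [Nonempty ι] (f : ι → D → A)

open Classical in
theorem marginal_ofFun (x : D) (a : A) :
    (ofFun f).marginal x a =
      ((Finset.univ.filter fun i => f i x = a).card : ℝ) / Fintype.card ι := by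
  unfold marginal ofFun
  simp only
  rw [← Finset.sum_div, ← Nat.cast_sum]
  congr 2
  rw [Finset.card_eq_sum_card_fiberwise (f := f)
    (t := (Finset.univ.image f).filter fun s => s x = a) (fun i hi => by simpa using hi)]
  refine Finset.sum_congr rfl fun s hs => congrArg Finset.card ?_
  rw [Finset.filter_filter]
  refine Finset.filter_congr fun i _ => ⟨?_, fun h => h.2⟩
  rintro rfl
  exact ⟨(Finset.mem_filter.1 hs).2, rfl⟩

open Classical in
theorem values_ofFun (x : D) : (ofFun f).values x = Finset.univ.image fun i => f i x := by
  unfold values ofFun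
  simp only
  rw [Finset.image_image]
  rfl

theorem sat_fd_ofFun_iff (y z : List D) :
    (ofFun f).Sat (.fd y z) ↔ ∀ i j, y.map (f i) = y.map (f j) → z.map (f i) = z.map (f j) := by
  simp [Sat, ofFun]

/-- A permutation of the indices that carries the partition induced by `x` to the partition
induced by `y` witnesses `x ≈* y`. -/
theorem sat_umde_ofFun (x y : D) (e : ι ≃ ι)
    (h : ∀ i j, f (e i) y = f (e j) y ↔ f i x = f j x) : (ofFun f).Sat (.umde x y) := by
  classical
  have hg : ∃ g : A → A, ∀ i, g (f i x) = f (e i) y := by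
    refine ⟨fun a => if h : ∃ i, f i x = a then f (e h.choose) y else a, fun i => ?_⟩
    have hi : ∃ j, f j x = f i x := ⟨i, rfl⟩
    beta_reduce
    rw [dif_pos hi]
    exact (h _ _).2 hi.choose_spec
  obtain ⟨g, hg⟩ := hg
  have hval : (ofFun f).values y = ((ofFun f).values x).image g := by
    ext a
    simp only [values_ofFun, Finset.image_image, Finset.mem_image, Finset.mem_univ, true_and,
      Function.comp, hg]
    exact ⟨fun ⟨i, hi⟩ => ⟨e.symm i, by simpa using hi⟩, fun ⟨i, hi⟩ => ⟨e i, hi⟩⟩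
  have hinj : Set.InjOn g ((ofFun f).values x) := by
    intro a ha b hb hab
    simp only [values_ofFun, Finset.coe_image, Finset.coe_univ, Set.image_univ] at ha hb
    obtain ⟨i, rfl⟩ := ha
    obtain ⟨j, rfl⟩ := hb
    rw [hg, hg] at hab
    exact (h i j).1 hab
  change (ofFun f).marginals x = (ofFun f).marginals y
  unfold marginals
  rw [hval, Finset.image_val_of_injOn hinj, Multiset.map_map]
  refine Multiset.map_congr rfl fun a ha => ?_
  rw [Finset.mem_val, values_ofFun, Finset.mem_image] at ha
  obtain ⟨i, -, rfl⟩ := ha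
  simp only [Function.comp, hg, marginal_ofFun]
  congr 2
  refine Finset.card_bij (fun j _ => e j) ?_ (fun _ _ _ _ h => e.injective h) ?_
  · intro j hj
    simpa [h] using hj
  · intro j hj
    refine ⟨e.symm j, ?_, by simp⟩
    have hj' : f (e (e.symm j)) y = f (e i) y := by simpa using hj
    simpa using (h _ _).1 hj'

end OfFun

theorem card_values_eq_of_sat_umde {D : Type u} {A : Type v} {X : ProbTeam D A} {x y : D}
    (h : X.Sat (.umde x y)) : (X.values x).card = (X.values y).card := by
  have h' : X.marginals x = X.marginals y := h
  simpa [marginals] using congrArg Multiset.card h'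

end ProbTeam

/-! ### Block teams -/

open Classical in
/-- The rows of a block team. There is a block of two rows for each `l : K`; these two rows agree
exactly on the variables in `C l`, and rows in different blocks disagree everywhere. The last
component of each value marks the variable `t`, so that no other variable shares a value
with `t`. -/
noncomputable def blockRow {D : Type u} {K : Type} (C : K → Set D) (t : D) (i : K × Bool) (w : D) :
    K × Bool × Bool :=
  (i.1, if w ∈ C i.1 then false else i.2, decide (w = t))

/-- The uniform team with rows `blockRow C t`. -/
noncomputable def blockTeam {D : Type u} {K : Type} [Fintype K] [Nonempty K]
    (C : K → Set D) (t : D) : ProbTeam D (K × Bool × Bool) :=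
  ProbTeam.ofFun (blockRow C t)

section BlockTeam

variable {D : Type u} {K : Type} (C : K → Set D) (t : D)

theorem blockRow_eq_iff (i j : K × Bool) (w : D) :
    blockRow C t i w = blockRow C t j w ↔ i.1 = j.1 ∧ (w ∈ C i.1 ∨ i.2 = j.2) := by
  obtain ⟨l, b⟩ := i
  obtain ⟨l', b'⟩ := j
  simp only [blockRow, Prod.mk.injEq, and_true]
  refine and_congr_right fun h => ?_
  subst h
  by_cases hw : w ∈ C l <;> simp [hw]

variable [Fintype K] [Nonempty K]

/-- A functional dependency holds in a block team if its antecedent is nonempty, or its consequent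
is empty, and all the sets `C l` are closed under it. -/
theorem blockTeam_sat_fd {y z : List D} (h0 : y = [] → z = [])
    (h : ∀ l, (∀ v ∈ y, v ∈ C l) → ∀ v ∈ z, v ∈ C l) : (blockTeam C t).Sat (.fd y z) := by
  rw [blockTeam, ProbTeam.sat_fd_ofFun_iff]
  intro i j hij
  simp only [List.map_inj_left, blockRow_eq_iff] at hij ⊢
  intro v hv
  by_cases hb : i.2 = j.2
  · obtain ⟨w, hw⟩ := List.exists_mem_of_ne_nil y fun hy => by simp [h0 hy] at hv
    exact ⟨(hij w hw).1, .inr hb⟩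
  · have hy : ∀ v ∈ y, v ∈ C i.1 := fun w hw => ((hij w hw).2).resolve_right hb
    obtain ⟨w, hw⟩ := List.exists_mem_of_ne_nil y fun hy => by simp [h0 hy] at hv
    exact ⟨(hij w hw).1, .inl (h i.1 hy v hv)⟩

theorem blockTeam_mem_of_sat_fd {y z : List D} (h : (blockTeam C t).Sat (.fd y z)) (l : K)
    (hy : ∀ v ∈ y, v ∈ C l) : ∀ v ∈ z, v ∈ C l := by
  rw [blockTeam, ProbTeam.sat_fd_ofFun_iff] at h
  have h' := h (l, false) (l, true)
  simp only [List.map_inj_left, blockRow_eq_iff] at h'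
  simpa using h' (by simpa using hy)

theorem blockTeam_eq_of_sat_umi {b : D} (h : (blockTeam C t).Sat (.umi t b)) : t = b := by
  classical
  by_contra hne
  obtain ⟨l⟩ := ‹Nonempty K›
  have h' := h (blockRow C t (l, false) t)
  have hpos : (0 : ℝ) < Fintype.card (K × Bool) := by
    exact_mod_cast Fintype.card_pos_iff.2 ⟨(l, false)⟩
  rw [blockTeam, ProbTeam.marginal_ofFun, ProbTeam.marginal_ofFun, div_left_inj' hpos.ne',
    Nat.cast_inj] at h'
  have h0 : ∀ i, ¬ blockRow C t i b = blockRow C t (l, false) t := fun i hi =>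
    hne (by simpa [blockRow] using congrArg (fun p => p.2.2) hi : b = t).symm
  simp only [h0, Finset.filter_false, Finset.card_empty, Finset.card_eq_zero,
    Finset.filter_eq_empty_iff] at h'
  exact h' (Finset.mem_univ (l, false)) rfl

open Classical in
theorem blockTeam_sat_umde {x y : D}
    (h : (Finset.univ.filter fun l => x ∈ C l).card = (Finset.univ.filter fun l => y ∈ C l).card) :
    (blockTeam C t).Sat (.umde x y) := by
  have hc : Fintype.card {l // x ∈ C l} = Fintype.card {l // y ∈ C l} := by
    rw [Fintype.card_subtype, Fintype.card_subtype, h]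
  let e := (Fintype.equivOfCardEq hc).extendSubtype
  have he : ∀ l, y ∈ C (e l) ↔ x ∈ C l := fun l =>
    ⟨fun hy => by_contra fun hx => Equiv.extendSubtype_not_mem (Fintype.equivOfCardEq hc) l hx hy,
      Equiv.extendSubtype_mem (Fintype.equivOfCardEq hc) l⟩
  refine ProbTeam.sat_umde_ofFun _ x y (e.prodCongr (Equiv.refl Bool)) fun i j => ?_
  simp [blockRow_eq_iff, he]

open Classical in
theorem card_values_blockTeam (x : D) :
    ((blockTeam C t).values x).card + (Finset.univ.filter fun l => x ∈ C l).card =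
      Fintype.card (K × Bool) := by
  -- the indices `(l, true)` with `x ∈ C l` are redundant, and the others give distinct values
  let T : Finset (K × Bool) := Finset.univ.filter fun i => x ∈ C i.1 ∧ i.2 = true
  have h1 : (blockTeam C t).values x = Tᶜ.image fun i => blockRow C t i x := by
    ext a
    simp only [blockTeam, ProbTeam.values_ofFun, Finset.mem_image, Finset.mem_univ, true_and]
    refine ⟨?_, fun ⟨i, _, hi⟩ => ⟨i, hi⟩⟩
    rintro ⟨i, rfl⟩
    by_cases hi : x ∈ C i.1
    · exact ⟨(i.1, false), by simp [T], by simp [blockRow_eq_iff, hi]⟩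
    · exact ⟨i, by simp [T, hi], rfl⟩
  have h2 : Set.InjOn (fun i => blockRow C t i x) (Tᶜ : Finset (K × Bool)) := by
    rintro ⟨l, b⟩ hi ⟨l', b'⟩ hj hij
    have hij' := (blockRow_eq_iff C t _ _ x).1 hij
    obtain ⟨rfl, hb⟩ : l = l' ∧ (x ∈ C l ∨ b = b') := hij'
    simp only [T, Finset.coe_compl, Finset.coe_filter, Finset.mem_univ, true_and,
      Set.mem_compl_iff, Set.mem_ofPred_eq, not_and, Bool.not_eq_true] at hi hj
    rcases hb with hb | hb
    · rw [hi hb, hj hb]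
    · rw [hb]
  have h3 : T.card = (Finset.univ.filter fun l => x ∈ C l).card := by
    refine Finset.card_bij (fun i _ => i.1) ?_ ?_ ?_
    · intro i hi
      simpa using (Finset.mem_filter.1 hi).2.1
    · rintro ⟨l, b⟩ hi ⟨l', b'⟩ hj (rfl : l = l')
      have hb : b = true := (Finset.mem_filter.1 hi).2.2
      have hb' : b' = true := (Finset.mem_filter.1 hj).2.2
      rw [hb, hb']
    · intro l hl
      exact ⟨(l, true), by simpa [T] using hl, rfl⟩
  rw [h1, Finset.card_image_of_injOn h2, ← h3, Finset.card_compl]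
  exact Nat.sub_add_cancel (Finset.card_le_univ _)

end BlockTeam

/-! ### The cyclic invariant -/

/-- `x i` is the antecedent of one of the functional dependencies of the cycle, and `v` is its
consequent. -/
def CycleArrow {V : Type u} (k : ℕ) (x : ℕ → V) (i : ℕ) (v : V) : Prop :=
  Even i ∧ i < k ∧ v = x (i + 1)

/-- `{a, b}` is the pair of variables of the equivalence `x j ≈* x (j + 1)` of the cycle. -/
def CycleLink {V : Type u} (k : ℕ) (x : ℕ → V) (j : ℕ) (a b : V) : Prop :=
  (a = x j ∧ b = x (cycleSucc k j)) ∨ (a = x (cycleSucc k j) ∧ b = x j)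

/-- The explicit closure of the cycle, enlarged by the trivial atoms over all variables of `V`.
Derivations may pass through atoms with variables off the cycle, so the invariant
has to cover these. -/
def InCycleClosure {V : Type u} (k : ℕ) (x : ℕ → V) : DepAtom V → Prop
  | .fd y z => ∀ v ∈ z, v ∈ y ∨ ∃ i, x i ∈ y ∧ CycleArrow k x i v
  | .umi a b => a = b
  | .umde a b => a = b ∨ ∃ j ≤ k, Odd j ∧ CycleLink k x j a b

/-- No atom of `Γ` does the work of the `c`-th atom of the cycle: for even `c`, no functional
dependency of `Γ` with antecedent `x c` alone has `x (c + 1)` in its consequent, and for odd `c`,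
the equivalence `x c ≈* x (c + 1)` is not in `Γ` in either direction. -/
def CycleMissing {V : Type u} (k : ℕ) (x : ℕ → V) (Γ : Set (DepAtom V)) (c : ℕ) : Prop :=
  (Even c → ∀ y z, DepAtom.fd y z ∈ Γ → (∀ v ∈ y, v = x c) → x (c + 1) ∉ z) ∧
  (Odd c → ∀ a b, DepAtom.umde a b ∈ Γ → ¬ CycleLink k x c a b)

theorem cycleSucc_le (k i : ℕ) : cycleSucc k i ≤ k := by
  unfold cycleSucc; split <;> omega

theorem even_cycleSucc {k j : ℕ} (hj : Odd j) : Even (cycleSucc k j) := by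
  unfold cycleSucc
  split
  · exact hj.add_one
  · exact Even.zero

theorem cycleSucc_of_even {k i : ℕ} (hk : Odd k) (hik : i ≤ k) (hi : Even i) :
    i < k ∧ cycleSucc k i = i + 1 := by
  have : i < k := lt_of_le_of_ne hik (by rintro rfl; exact (Nat.not_even_iff_odd.2 hk) hi)
  exact ⟨this, if_pos this⟩

/-- At most `k` atoms of the invariant cannot do the work of all `k + 1` atoms of the cycle, since
no atom does the work of two of them. -/
theorem exists_cycleMissing {V : Type u} {k n : ℕ} (hn : n ≤ k) {x : ℕ → V}
    (hx : Set.InjOn x (Set.Iic k)) (p : Fin n → DepAtom V) (hp : ∀ i, InCycleClosure k x (p i)) :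
    ∃ c ≤ k, CycleMissing k x (Set.range p) c := by
  by_contra! hcon
  have hw : ∀ c : Fin (k + 1), ∃ i : Fin n,
      (Even c.1 ∧ ∃ y z, p i = .fd y z ∧ (∀ v ∈ y, v = x c) ∧ y ≠ []) ∨
      (Odd c.1 ∧ ∃ a b, p i = .umde a b ∧ CycleLink k x c a b) := by
    intro c
    have h := hcon c (Nat.lt_succ_iff.1 c.2)
    simp only [CycleMissing, not_and_or] at h
    push Not at h
    rcases h with ⟨hc, y, z, ⟨i, hi⟩, hy, hz⟩ | ⟨hc, a, b, ⟨i, hi⟩, hl⟩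
    · refine ⟨i, .inl ⟨hc, y, z, hi, hy, ?_⟩⟩
      rintro rfl
      have := hp i
      rw [hi] at this
      simpa using this _ hz
    · exact ⟨i, .inr ⟨hc, a, b, hi, hl⟩⟩
  choose g hg using hw
  have hinj : Function.Injective g := by
    intro c d hcd
    have hc := hg c
    have hd := hg d
    have hck : c.1 ≤ k := Nat.lt_succ_iff.1 c.2
    have hdk : d.1 ≤ k := Nat.lt_succ_iff.1 d.2
    rw [← hcd] at hd
    refine Fin.ext ?_
    rcases hc with ⟨-, y, z, hi, hy, hne⟩ | ⟨hc, a, b, hi, hl⟩ <;>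
      rcases hd with ⟨-, y', z', hi', hy', hne'⟩ | ⟨hd, a', b', hi', hl'⟩ <;>
      rw [hi] at hi' <;> cases hi'
    · obtain ⟨v, hv⟩ := List.exists_mem_of_ne_nil y hne
      exact hx hck hdk ((hy v hv).symm.trans (hy' v hv))
    · -- a link has one end with odd index, and this index determines the link
      have key : ∀ {i j}, i ≤ k → Odd i → Odd j → x i ≠ x (cycleSucc k j) := by
        intro i j hi hio hjo h
        rw [hx hi (cycleSucc_le k j) h] at hio
        exact Nat.not_odd_iff_even.2 (even_cycleSucc hjo) hio
      rcases hl with ⟨h1, h2⟩ | ⟨h1, h2⟩ <;> rcases hl' with ⟨h3, h4⟩ | ⟨h3, h4⟩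
      · exact hx hck hdk (h1.symm.trans h3)
      · exact (key hck hc hd (h1.symm.trans h3)).elim
      · exact (key hck hc hd (h2.symm.trans h4)).elim
      · exact hx hck hdk (h2.symm.trans h4)
  have := Fintype.card_le_of_injective g hinj
  simp at this
  omega

open Classical in
/-- A potential on the variables. When the cycle is cut open at its `c`-th atom, the potential is
constant along the links and goes up by one along the arrows. It takes the same value on
two cycle variables only if they are equal or linked, and it takes a value of its own on `t` if `t`
is off the cycle. -/
theorem exists_potential {V : Type u} {k c : ℕ} (hk : Odd k) (hc : c ≤ k) {x : ℕ → V}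
    (hx : Set.InjOn x (Set.Iic k)) (t : V) :
    ∃ M : V → ℕ, (∀ w, 1 ≤ M w) ∧ (∀ w, M w ≤ k + 4) ∧
      (∀ i v, i ≠ c → CycleArrow k x i v → M v = M (x i) + 1) ∧
      (∀ j ≤ k, Odd j → j ≠ c → ∀ a b, CycleLink k x j a b → M a = M b) ∧
      (∀ b, M t = M b → t = b ∨ ∃ j ≤ k, Odd j ∧ CycleLink k x j t b) := by
  let N : ℕ → ℕ := fun i => (i + 1) / 2 + 2 + if i ≤ c then (k + 1) / 2 else 0
  let M : V → ℕ := fun w =>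
    if h : ∃ i ≤ k, w = x i then N h.choose else if w = t then k + 4 else 1
  have hM : ∀ i ≤ k, M (x i) = N i := by
    intro i hi
    have h : ∃ j ≤ k, x i = x j := ⟨i, hi, rfl⟩
    have : h.choose = i := (hx hi h.choose_spec.1 h.choose_spec.2).symm
    simp only [M, dif_pos h, this]
  have hM' : ∀ w, (¬ ∃ i ≤ k, w = x i) → M w = if w = t then k + 4 else 1 := fun w h => by
    simp only [M, dif_neg h]
  have hN : ∀ i ≤ k, 2 ≤ N i ∧ N i < k + 4 := by
    intro i hi
    obtain ⟨m, rfl⟩ := hk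
    simp only [N]
    split <;> omega
  have hlink : ∀ j ≤ k, Odd j → j ≠ c → M (x j) = M (x (cycleSucc k j)) := by
    intro j hj hjo hjc
    rw [hM j hj, hM _ (cycleSucc_le k j)]
    obtain ⟨m, rfl⟩ := hk
    obtain ⟨n, rfl⟩ := hjo
    simp only [N, cycleSucc]
    split_ifs <;> omega
  refine ⟨M, fun w => ?_, fun w => ?_, ?_, ?_, ?_⟩
  · by_cases h : ∃ i ≤ k, w = x i
    · obtain ⟨i, hi, rfl⟩ := h
      rw [hM i hi]
      have := hN i hi
      omega
    · rw [hM' w h]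
      split <;> omega
  · by_cases h : ∃ i ≤ k, w = x i
    · obtain ⟨i, hi, rfl⟩ := h
      rw [hM i hi]
      have := hN i hi
      omega
    · rw [hM' w h]
      split <;> omega
  · rintro i v hic ⟨⟨n, rfl⟩, hik, rfl⟩
    rw [hM _ hik.le, hM _ hik]
    simp only [N]
    split_ifs <;> omega
  · rintro j hj hjo hjc a b (⟨rfl, rfl⟩ | ⟨rfl, rfl⟩)
    · exact hlink j hj hjo hjc
    · exact (hlink j hj hjo hjc).symm
  · intro b hb
    by_cases ht : ∃ i ≤ k, t = x i
    · obtain ⟨i, hi, rfl⟩ := ht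
      by_cases hb' : ∃ i ≤ k, b = x i
      · obtain ⟨j, hj, rfl⟩ := hb'
        rw [hM i hi, hM j hj] at hb
        by_cases hij : i = j
        · exact .inl (by rw [hij])
        right
        -- equal potentials at different indices: up to wrapping around, they are `2m+1` and `2m+2`
        have key : (Odd i ∧ j = cycleSucc k i) ∨ (Odd j ∧ i = cycleSucc k j) := by
          obtain ⟨m, rfl⟩ := hk
          simp only [cycleSucc]
          obtain ⟨n, rfl | rfl⟩ := Nat.even_or_odd' i <;>
            obtain ⟨n', rfl | rfl⟩ := Nat.even_or_odd' j <;>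
            simp only [N, Nat.odd_iff] at hb ⊢ <;> split_ifs at hb ⊢ <;> omega
        rcases key with ⟨ho, rfl⟩ | ⟨ho, rfl⟩
        · exact ⟨i, hi, ho, .inl ⟨rfl, rfl⟩⟩
        · exact ⟨j, hj, ho, .inr ⟨rfl, rfl⟩⟩
      · rw [hM i hi, hM' b hb', if_neg (by rintro rfl; exact hb' ⟨i, hi, rfl⟩)] at hb
        have := hN i hi
        omega
    · rw [hM' t ht, if_pos rfl] at hb
      by_cases hb' : ∃ i ≤ k, b = x i
      · obtain ⟨j, hj, rfl⟩ := hb'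
        rw [hM j hj] at hb
        have := hN j hj
        omega
      · rw [hM' b hb'] at hb
        split at hb
        · exact .inl (by symm; assumption)
        · omega

open Classical in
/-- The family of sets behind the countermodels: `C₀`, and, for each `l < R`, the variables of `S`,
and those outside of `S`, at which the potential minus the indicator function of `C₀`
exceeds `l`. -/
def potentialFamily {V : Type u} (R : ℕ) (M : V → ℕ) (C₀ S : Set V) :
    Option (Fin R × Bool) → Set V
  | none => C₀
  | some (l, b) => {w | (w ∈ S ↔ b = true) ∧ l.1 < M w - if w ∈ C₀ then 1 else 0}

open Classical in
/-- The number of members of the family that contain `w` is the potential of `w`. -/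
theorem card_potentialFamily {V : Type u} {R : ℕ} {M : V → ℕ} (C₀ S : Set V) {w : V}
    (h1 : 1 ≤ M w) (hR : M w ≤ R) :
    (Finset.univ.filter fun l => w ∈ potentialFamily R M C₀ S l).card = M w := by
  have hset : (Finset.univ.filter fun l => w ∈ potentialFamily R M C₀ S l) =
      (if w ∈ C₀ then {none} else ∅) ∪
        ((Finset.univ.filter fun l : Fin R => l.1 < M w - if w ∈ C₀ then 1 else 0).image
          fun l => some (l, decide (w ∈ S))) := by
    ext l
    rw [Finset.mem_filter]
    rcases l with _ | ⟨l, b⟩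
    · by_cases hw : w ∈ C₀ <;> simp [potentialFamily, hw]
    · by_cases hw : w ∈ C₀ <;> by_cases hS : w ∈ S <;> cases b <;>
        simp [potentialFamily, hw, hS]
  rw [hset, Finset.card_union_of_disjoint, Finset.card_image_of_injective,
    Fin.card_filter_val_lt]
  · by_cases hw : w ∈ C₀ <;> simp [hw] <;> omega
  · intro a b hab
    simpa using hab
  · by_cases hw : w ∈ C₀ <;> simp [hw]

theorem DepAtom.exists_map_eq {V : Type u} {D : Finset V} (τ : DepAtom V)
    (h : τ.vars ⊆ D) : ∃ τ' : DepAtom D, τ'.map Subtype.val = τ := by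
  cases τ with
  | fd y z =>
    refine ⟨.fd (y.attachWith (· ∈ D) fun v hv => h (.inl hv))
      (z.attachWith (· ∈ D) fun v hv => h (.inr hv)), ?_⟩
    simp [DepAtom.map]
  | umi a b => exact ⟨.umi ⟨a, h (.inl rfl)⟩ ⟨b, h (.inr rfl)⟩, rfl⟩
  | umde a b => exact ⟨.umde ⟨a, h (.inl rfl)⟩ ⟨b, h (.inr rfl)⟩, rfl⟩

theorem DepAtom.map_injective {V : Type u} {W : Type v} {f : V → W} (hf : Function.Injective f) :
    Function.Injective (DepAtom.map f) := by
  intro σ τ h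
  cases σ <;> cases τ <;> simp [DepAtom.map, hf.eq_iff, (List.map_injective_iff.2 hf).eq_iff] at h ⊢
    <;> exact h

theorem DepAtom.finite_vars {V : Type u} (τ : DepAtom V) : τ.vars.Finite := by
  cases τ with
  | fd y z => exact (List.finite_toSet (y ++ z)).subset fun v hv => by simpa [DepAtom.vars] using hv
  | umi a b => exact Set.toFinite {a, b}
  | umde a b => exact Set.toFinite {a, b}

theorem finite_varsOf_range {V : Type u} {n : ℕ} (p : Fin n → DepAtom V) :
    (varsOf (Set.range p)).Finite :=
  (Set.finite_range p).biUnion fun τ _ => τ.finite_vars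

theorem DepAtom.vars_subset_varsOf {V : Type u} {Γ : Set (DepAtom V)} {τ : DepAtom V}
    (h : τ ∈ Γ) : τ.vars ⊆ varsOf Γ :=
  Set.subset_biUnion_of_mem (u := fun τ : DepAtom V => τ.vars) h

open Classical in
/-- If the work of the `c`-th atom of the cycle is missing from `Γ`, then `Γ` has only
consequences in the invariant. The countermodel is the block team of the
`potentialFamily` with `S = {x c}` for even `c` and `S = ∅` for odd `c`, and with `C₀` the closure of
the antecedent of the conclusion (with `C₀ = ∅` if the conclusion is an equivalence). -/
theorem inCycleClosure_of_entails {V : Type u} {k c : ℕ} (hk : Odd k) (hc : c ≤ k) {x : ℕ → V}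
    (hx : Set.InjOn x (Set.Iic k)) {Γ : Set (DepAtom V)} (hfin : (varsOf Γ).Finite)
    (hΓ : ∀ τ ∈ Γ, InCycleClosure k x τ) (hmiss : CycleMissing k x Γ c) {σ : DepAtom V}
    (hσ : Entails Γ σ) : InCycleClosure k x σ := by
  have hD : (varsOf Γ ∪ σ.vars).Finite := hfin.union σ.finite_vars
  let D : Finset V := hD.toFinset
  have hΓD : ∀ τ ∈ Γ, τ.vars ⊆ D := fun τ hτ v hv => by
    simpa [D] using Or.inl (DepAtom.vars_subset_varsOf hτ hv)
  obtain ⟨σ', hσ'⟩ := σ.exists_map_eq (D := D) fun v hv => by simpa [D] using Or.inr hv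
  -- the block teams for the tag `t` and the closure of `y` satisfy `Γ`, and hence `σ`
  have key : ∀ (t : D) (y : List V), ∃ (K : Type) (_ : Fintype K) (_ : Nonempty K)
      (C : K → Set D) (M : V → ℕ),
      (∃ l, C l = {w : D | w.1 ∈ y ∨ ∃ i, x i ∈ y ∧ CycleArrow k x i w}) ∧
      (∀ w, (Finset.univ.filter fun l => w ∈ C l).card = M w) ∧
      (∀ b, M t = M b → t.1 = b ∨ ∃ j ≤ k, Odd j ∧ CycleLink k x j t b) ∧
      (blockTeam C t).Sat σ' := by
    intro t y
    obtain ⟨M, hM1, hM2, hMarrow, hMlink, hMsep⟩ := exists_potential hk hc hx t.1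
    let C₀ : Set V := {w | w ∈ y ∨ ∃ i, x i ∈ y ∧ CycleArrow k x i w}
    let S : Set V := {w | Even c ∧ w = x c}
    let F := potentialFamily (k + 4) M C₀ S
    let C : Option (Fin (k + 4) × Bool) → Set D := fun l => {w | w.1 ∈ F l}
    have hcard : ∀ w : D, (Finset.univ.filter fun l => w ∈ C l).card = M w := fun w =>
      card_potentialFamily C₀ S (hM1 w) (hM2 w)
    have hclosed : ∀ y z : List V, DepAtom.fd y z ∈ Γ → ∀ l, (∀ v ∈ y, v ∈ F l) →
        ∀ v ∈ z, v ∈ F l := by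
      intro y' z' hτ l hl v hv
      rcases hΓ _ hτ v hv with hvy | ⟨i, hiy, hiv⟩
      · exact hl v hvy
      have hxi := hl _ hiy
      have hvx : v = x (i + 1) := hiv.2.2
      have hvS : v ∉ S := by
        rintro ⟨hce, h⟩
        rw [hvx] at h
        have := hx hiv.2.1 hc h
        rw [← this] at hce
        exact Nat.not_even_iff_odd.2 hiv.1.add_one hce
      rcases l with _ | ⟨l, _ | _⟩
      · rcases hxi with hxi | ⟨i', -, hi'⟩
        · exact .inr ⟨i, hxi, hiv⟩
        · have := hx hiv.2.1.le hi'.2.1 hi'.2.2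
          have he := hiv.1
          rw [this] at he
          exact (Nat.not_even_iff_odd.2 hi'.1.add_one he).elim
      · -- outside of `S` only arrows other than the `c`-th matter, and the potential goes up by one
        obtain ⟨hxS, hlt⟩ := hxi
        have hic : i ≠ c := by
          rintro rfl
          exact Bool.false_ne_true (hxS.1 ⟨hiv.1, rfl⟩)
        refine ⟨by simp [hvS], ?_⟩
        rw [hMarrow i v hic hiv]
        split_ifs at hlt ⊢ <;> omega
      · -- inside of `S` the antecedent is `x c` alone, which is what `hmiss` excludes
        have hyS : ∀ w ∈ y', Even c ∧ w = x c := fun w hw => (hl w hw).1.2 rfl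
        have hic : i = c := hx hiv.2.1.le hc (hyS _ hiy).2
        subst hic
        exact (hmiss.1 hiv.1 y' z' hτ (fun w hw => (hyS w hw).2) (hvx ▸ hv)).elim
    refine ⟨_, inferInstance, inferInstance, C, M, ⟨none, rfl⟩, hcard, hMsep, ?_⟩
    refine hσ D _ (blockTeam C t) σ' hσ' fun τ hτ => ?_
    obtain ⟨τ', rfl⟩ := τ.exists_map_eq (hΓD τ hτ)
    refine ⟨τ', rfl, ?_⟩
    have hin := hΓ _ hτ
    cases τ' with
    | fd y z =>
      refine blockTeam_sat_fd C t ?_ ?_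
      · rintro rfl
        refine List.eq_nil_iff_forall_not_mem.2 fun v hv => ?_
        simpa using hin v.1 (List.mem_map_of_mem hv)
      · intro l hl v hv
        refine hclosed _ _ hτ l ?_ v.1 (List.mem_map_of_mem hv)
        intro w hw
        obtain ⟨w', hw', rfl⟩ := List.mem_map.1 hw
        exact hl w' hw'
    | umi a b =>
      rw [Subtype.ext hin]
      exact fun _ => rfl
    | umde a b =>
      refine blockTeam_sat_umde C t ?_
      rw [hcard, hcard]
      rcases hin with h | ⟨j, hj, hjo, hl⟩
      · rw [h]
      · exact hMlink j hj hjo (by rintro rfl; exact hmiss.2 hjo _ _ hτ hl) _ _ hl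
  rw [← hσ']
  cases σ' with
  | fd y z =>
    intro v hv
    obtain ⟨w, hw, rfl⟩ := List.mem_map.1 hv
    obtain ⟨K, _, _, C, M, ⟨l, hl⟩, -, -, hsat⟩ := key w (y.map Subtype.val)
    have h := blockTeam_mem_of_sat_fd C w hsat l
      (fun u hu => by rw [hl]; exact .inl (List.mem_map_of_mem hu)) w hw
    rw [hl] at h
    exact h
  | umi a b =>
    obtain ⟨K, _, _, C, M, -, -, -, hsat⟩ := key a []
    exact congrArg Subtype.val (blockTeam_eq_of_sat_umi C a hsat)
  | umde a b =>
    obtain ⟨K, _, _, C, M, -, hcard, hsep, hsat⟩ := key a []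
    refine hsep b ?_
    have h := ProbTeam.card_values_eq_of_sat_umde hsat
    have ha := card_values_blockTeam C a a
    have hb := card_values_blockTeam C a b
    rw [hcard] at ha hb
    omega

theorem inCycleClosure_of_mem_cycleAtoms {V : Type u} {k : ℕ} (hk : Odd k) {x : ℕ → V}
    {σ : DepAtom V} (h : σ ∈ cycleAtoms k x) : InCycleClosure k x σ := by
  rcases h with ⟨i, hi, hie, rfl⟩ | ⟨j, hj, hjo, rfl⟩
  · obtain ⟨hlt, hs⟩ := cycleSucc_of_even hk hi hie
    intro v hv
    rw [hs] at hv
    exact .inr ⟨i, by simp, hie, hlt, by simpa using hv⟩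
  · exact .inr ⟨j, hj, hjo, .inl ⟨rfl, rfl⟩⟩

/-- The invariant is preserved by sound rules that are at most `k`-ary. -/
theorem inCycleClosure_of_derives {V : Type u} {k : ℕ} (hk : Odd k) {x : ℕ → V}
    (hx : Set.InjOn x (Set.Iic k)) {σ : DepAtom V}
    (h : Derives {R : InferenceRule V | R.IsSound ∧ R.arity ≤ k} (cycleAtoms k x) σ) :
    InCycleClosure k x σ := by
  induction h with
  | hyp σ h => exact inCycleClosure_of_mem_cycleAtoms hk h
  | rule R hR p hp _ σ hσ ih =>
    obtain ⟨c, hc, hmiss⟩ := exists_cycleMissing hR.2 hx p.1 ih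
    refine inCycleClosure_of_entails hk hc hx (finite_varsOf_range p.1) ?_ hmiss (hR.1 p hp σ hσ)
    rintro τ ⟨i, rfl⟩
    exact ih i

theorem not_inCycleClosure_reversed {V : Type u} {k : ℕ} (hk : 1 ≤ k) {x : ℕ → V}
    (hx : Set.InjOn x (Set.Iic k)) : ¬ InCycleClosure k x (.fd [x 1] [x 0]) := by
  intro h
  rcases h (x 0) (by simp) with h | ⟨i, -, -, hik, h⟩
  · have := hx (Nat.zero_le k) hk (List.mem_singleton.1 h)
    omega
  · have := hx (Nat.zero_le k) hik h
    omega

/-! ### The explicit closure -/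

theorem CycleFD.inCycleClosure {V : Type u} {k : ℕ} {x : ℕ → V} {y z : List V}
    (h : CycleFD k x y z) : InCycleClosure k x (.fd y z) := by
  induction h with
  | triv y z hz hy => exact fun v hv => .inl (hz v hv)
  | step y z _ i hi hik ih =>
    intro v hv
    rcases List.mem_append.1 hv with hv | hv
    · rcases ih v hv with h | ⟨j, hj, h⟩
      · exact .inl (List.mem_append_left _ h)
      · exact .inr ⟨j, List.mem_append_left _ hj, h⟩
    · exact .inr ⟨i, by simp, hi, hik, by simpa using hv⟩
  | congr y z y' z' _ hy hz ih =>
    intro v hv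
    simpa only [hy] using ih v ((hz v).2 hv)

theorem CycleFD.vars_subset {V : Type u} {k : ℕ} {x : ℕ → V} {y z : List V}
    (h : CycleFD k x y z) : (DepAtom.fd y z).vars ⊆ {v | ∃ i ≤ k, v = x i} := by
  suffices hy : ∀ v ∈ y, ∃ i ≤ k, v = x i by
    rintro v (hv | hv)
    · exact hy v hv
    · rcases h.inCycleClosure v hv with hv | ⟨i, -, -, hik, rfl⟩
      · exact hy v hv
      · exact ⟨i + 1, hik, rfl⟩
  induction h with
  | triv y z _ hy => exact hy
  | step y z _ i _ hik ih =>
    intro v hv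
    rcases List.mem_append.1 hv with hv | hv
    · exact ih v hv
    · exact ⟨i, hik.le, by simpa using hv⟩
  | congr y z y' z' _ hy _ ih => exact fun v hv => ih v ((hy v).2 hv)

theorem cycleFD_of_inCycleClosure {V : Type u} {k : ℕ} {x : ℕ → V} {y z : List V}
    (hy : ∀ v ∈ y, ∃ i ≤ k, v = x i) (h : InCycleClosure k x (.fd y z)) : CycleFD k x y z := by
  classical
  -- the consequents of arrows are added one by one to the part of `z` that lies in `y`
  have key : ∀ w : List V, (∀ v ∈ w, ∃ i, x i ∈ y ∧ CycleArrow k x i v) →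
      CycleFD k x y (w ++ z.filter (· ∈ y)) := by
    intro w
    induction w with
    | nil => exact fun _ => .triv _ _ (fun v hv => by simpa using (List.mem_filter.1 hv).2) hy
    | cons v w ih =>
      intro hw
      obtain ⟨i, hi, hie, hik, rfl⟩ := hw v (by simp)
      refine .congr _ _ _ _ (.step _ _ (ih fun u hu => hw u (by simp [hu])) i hie hik) ?_ ?_
      · intro u
        simp only [List.mem_append, List.mem_singleton, or_iff_left_iff_imp]
        rintro rfl
        exact hi
      · intro u
        simp only [List.mem_append, List.mem_cons]
        tauto
  refine .congr _ _ _ _ (key (z.filter (· ∉ y)) fun v hv => ?_) (fun _ => Iff.rfl) fun v => ?_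
  · obtain ⟨hvz, hvy⟩ := List.mem_filter.1 hv
    exact (h v hvz).resolve_left (by simpa using hvy)
  · simp only [List.mem_append, List.mem_filter, decide_eq_true_eq]
    tauto

theorem varsOf_cycleAtoms {V : Type u} (k : ℕ) (x : ℕ → V) :
    varsOf (cycleAtoms k x) = {v | ∃ i ≤ k, v = x i} := by
  ext v
  simp only [varsOf, Set.mem_iUnion, exists_prop]
  constructor
  · rintro ⟨τ, ⟨i, hi, -, rfl⟩ | ⟨i, hi, -, rfl⟩, hv⟩
    · rcases hv with hv | hv
      · exact ⟨i, hi, by simpa using hv⟩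
      · exact ⟨_, cycleSucc_le k i, by simpa using hv⟩
    · rcases hv with hv | hv
      · exact ⟨i, hi, hv⟩
      · exact ⟨_, cycleSucc_le k i, hv⟩
  · rintro ⟨i, hi, rfl⟩
    rcases Nat.even_or_odd i with h | h
    · exact ⟨_, .inl ⟨i, hi, h, rfl⟩, .inl (by simp)⟩
    · exact ⟨_, .inr ⟨i, hi, h, rfl⟩, .inl rfl⟩

theorem mem_explicitClosure_iff {V : Type u} {k : ℕ} (hk : Odd k) {x : ℕ → V} {σ : DepAtom V} :
    σ ∈ explicitClosure k x ↔ σ.vars ⊆ varsOf (cycleAtoms k x) ∧ InCycleClosure k x σ := by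
  constructor
  · rintro ((((h | ⟨i, hi, rfl⟩) | ⟨i, hi, rfl⟩) | ⟨j, hj, hjo, rfl⟩) | ⟨y, z, h, rfl⟩)
    · exact ⟨DepAtom.vars_subset_varsOf h, inCycleClosure_of_mem_cycleAtoms hk h⟩
    · rw [varsOf_cycleAtoms]
      refine ⟨?_, rfl⟩
      rintro v (rfl | rfl) <;> exact ⟨i, hi, rfl⟩
    · rw [varsOf_cycleAtoms]
      refine ⟨?_, .inl rfl⟩
      rintro v (rfl | rfl) <;> exact ⟨i, hi, rfl⟩
    · rw [varsOf_cycleAtoms]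
      refine ⟨?_, .inr ⟨j, hj, hjo, .inr ⟨rfl, rfl⟩⟩⟩
      rintro v (rfl | rfl)
      · exact ⟨_, cycleSucc_le k j, rfl⟩
      · exact ⟨j, hj, rfl⟩
    · rw [varsOf_cycleAtoms]
      exact ⟨h.vars_subset, h.inCycleClosure⟩
  · rw [varsOf_cycleAtoms]
    rintro ⟨hv, h⟩
    cases σ with
    | fd y z =>
      exact .inr ⟨y, z, cycleFD_of_inCycleClosure (fun v h => hv (.inl h)) h, rfl⟩
    | umi a b =>
      obtain rfl : a = b := h
      obtain ⟨i, hi, rfl⟩ := hv (.inl rfl)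
      exact .inl (.inl (.inl (.inr ⟨i, hi, rfl⟩)))
    | umde a b =>
      rcases h with rfl | ⟨j, hj, hjo, ⟨rfl, rfl⟩ | ⟨rfl, rfl⟩⟩
      · obtain ⟨i, hi, rfl⟩ := hv (.inl rfl)
        exact .inl (.inl (.inr ⟨i, hi, rfl⟩))
      · exact .inl (.inl (.inl (.inl (.inr ⟨j, hj, hjo, rfl⟩))))
      · exact .inl (.inr ⟨j, hj, hjo, rfl⟩)

/-! ### Derivability of the explicit closure -/

/-- To apply some sound rule of arity at most `k` it suffices that at most `k` derived atoms
entail the conclusion, as the single instance is a rule. -/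
theorem derives_of_entails {V : Type u} {k n : ℕ} (hn : n ≤ k) {Γ : Set (DepAtom V)}
    {σ : DepAtom V} (p : Fin n → DepAtom V) (h : Entails (Set.range p) σ)
    (hp : ∀ i, Derives {R : InferenceRule V | R.IsSound ∧ R.arity ≤ k} Γ (p i)) :
    Derives {R : InferenceRule V | R.IsSound ∧ R.arity ≤ k} Γ σ := by
  let R : InferenceRule V := ⟨n, {(p, [σ])}⟩
  have hR : R ∈ {R : InferenceRule V | R.IsSound ∧ R.arity ≤ k} := by
    refine ⟨?_, hn⟩
    rintro q rfl δ hδ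
    rwa [List.mem_singleton.1 hδ]
  exact .rule R hR (p, [σ]) rfl hp σ (by simp)

theorem ProbTeam.sat_fd_iff {D : Type u} {A : Type v} {X : ProbTeam D A} {y z : List D} :
    X.Sat (.fd y z) ↔ ∀ s ∈ X.rows, ∀ s' ∈ X.rows,
      (∀ v ∈ y, s v = s' v) → ∀ v ∈ z, s v = s' v := by
  simp only [Sat, List.map_inj_left]

/-- Entailment, with the lifts of the antecedents to atoms over `D` resolved. -/
theorem entails_of_sat {V : Type u} {Γ : Set (DepAtom V)} {σ : DepAtom V}
    (h : ∀ (D : Finset V) (A : Type) (X : ProbTeam D A) (σ' : DepAtom D),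
      σ'.map Subtype.val = σ → varsOf Γ ⊆ D →
      (∀ τ : DepAtom D, τ.map Subtype.val ∈ Γ → X.Sat τ) → X.Sat σ') : Entails Γ σ := by
  intro D A _ X σ' hσ' hΓ
  refine h D A X σ' hσ' ?_ ?_
  · intro v hv
    simp only [varsOf, Set.mem_iUnion, exists_prop] at hv
    obtain ⟨τ, hτ, hv⟩ := hv
    obtain ⟨τ', rfl, -⟩ := hΓ τ hτ
    cases τ' with
    | fd y z =>
      have hv' : v ∈ y.map Subtype.val ∨ v ∈ z.map Subtype.val := hv
      simp only [List.mem_map] at hv'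
      rcases hv' with ⟨w, -, rfl⟩ | ⟨w, -, rfl⟩ <;> exact w.2
    | umi a b =>
      rcases hv with rfl | rfl
      exacts [a.2, b.2]
    | umde a b =>
      rcases hv with rfl | rfl
      exacts [a.2, b.2]
  · intro τ hτ
    obtain ⟨τ', h, hs⟩ := hΓ _ hτ
    rwa [← DepAtom.map_injective Subtype.val_injective h]

theorem entails_umi_refl {V : Type u} (Γ : Set (DepAtom V)) (a : V) : Entails Γ (.umi a a) := by
  refine entails_of_sat fun D A X σ' hσ' _ _ => ?_
  cases σ' with
  | umi b c =>
    simp only [DepAtom.map, DepAtom.umi.injEq] at hσ'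
    rw [Subtype.ext (hσ'.1.trans hσ'.2.symm)]
    exact fun _ => rfl
  | _ => simp [DepAtom.map] at hσ'

theorem entails_umde_refl {V : Type u} (Γ : Set (DepAtom V)) (a : V) : Entails Γ (.umde a a) := by
  refine entails_of_sat fun D A X σ' hσ' _ _ => ?_
  cases σ' with
  | umde b c =>
    simp only [DepAtom.map, DepAtom.umde.injEq] at hσ'
    rw [Subtype.ext (hσ'.1.trans hσ'.2.symm)]
    exact (rfl : X.marginals c = X.marginals c)
  | _ => simp [DepAtom.map] at hσ'

theorem entails_umde_symm {V : Type u} {Γ : Set (DepAtom V)} {a b : V} (h : .umde a b ∈ Γ) :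
    Entails Γ (.umde b a) := by
  refine entails_of_sat fun D A X σ' hσ' _ hX => ?_
  cases σ' with
  | umde c d =>
    simp only [DepAtom.map, DepAtom.umde.injEq] at hσ'
    obtain ⟨rfl, rfl⟩ := hσ'
    have hX' : X.marginals d = X.marginals c := hX (.umde d c) h
    exact hX'.symm
  | _ => simp [DepAtom.map] at hσ'

theorem entails_fd_of_subset {V : Type u} (Γ : Set (DepAtom V)) {y z : List V}
    (h : ∀ v ∈ z, v ∈ y) : Entails Γ (.fd y z) := by
  refine entails_of_sat fun D A X σ' hσ' _ _ => ?_
  cases σ' with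
  | fd y' z' =>
    simp only [DepAtom.map, DepAtom.fd.injEq] at hσ'
    obtain ⟨rfl, rfl⟩ := hσ'
    refine ProbTeam.sat_fd_iff.2 fun s _ s' _ hs v hv => hs v ?_
    simpa using h v (List.mem_map_of_mem hv)
  | _ => simp [DepAtom.map] at hσ'

theorem entails_fd_congr {V : Type u} {Γ : Set (DepAtom V)} {y z y' z' : List V}
    (h : .fd y z ∈ Γ) (hy : ∀ v, v ∈ y ↔ v ∈ y') (hz : ∀ v, v ∈ z ↔ v ∈ z') :
    Entails Γ (.fd y' z') := by
  refine entails_of_sat fun D A X σ' hσ' hD hX => ?_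
  obtain ⟨τ, hτ⟩ := DepAtom.exists_map_eq _ ((DepAtom.vars_subset_varsOf h).trans hD)
  have hsat := hX τ (hτ ▸ h)
  cases σ' with
  | fd u' w' =>
    cases τ with
    | fd u w =>
      simp only [DepAtom.map, DepAtom.fd.injEq] at hσ' hτ
      obtain ⟨rfl, rfl⟩ := hσ'
      obtain ⟨rfl, rfl⟩ := hτ
      rw [ProbTeam.sat_fd_iff] at hsat ⊢
      intro s hs s' hs' hss v hv
      refine hsat s hs s' hs' (fun v hv => hss v ?_) v ?_
      · simpa using (hy v.1).1 (List.mem_map_of_mem hv)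
      · simpa using (hz v.1).2 (List.mem_map_of_mem hv)
    | _ => simp [DepAtom.map] at hτ
  | _ => simp [DepAtom.map] at hσ'

theorem entails_fd_append {V : Type u} {Γ : Set (DepAtom V)} {y z y' z' : List V}
    (h : .fd y z ∈ Γ) (h' : .fd y' z' ∈ Γ) : Entails Γ (.fd (y ++ y') (z ++ z')) := by
  refine entails_of_sat fun D A X σ' hσ' hD hX => ?_
  obtain ⟨τ, hτ⟩ := DepAtom.exists_map_eq _ ((DepAtom.vars_subset_varsOf h).trans hD)
  obtain ⟨τ', hτ'⟩ := DepAtom.exists_map_eq _ ((DepAtom.vars_subset_varsOf h').trans hD)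
  have hsat := hX τ (hτ ▸ h)
  have hsat' := hX τ' (hτ' ▸ h')
  cases τ with
  | fd u w =>
    cases τ' with
    | fd u' w' =>
      simp only [DepAtom.map, DepAtom.fd.injEq] at hτ hτ'
      obtain ⟨rfl, rfl⟩ := hτ
      obtain ⟨rfl, rfl⟩ := hτ'
      have : σ' = .fd (u ++ u') (w ++ w') :=
        DepAtom.map_injective Subtype.val_injective 
          (hσ'.trans (by simp [DepAtom.map]))
      subst this
      rw [ProbTeam.sat_fd_iff] at hsat hsat' ⊢
      intro s hs s' hs' hss v hv
      rcases List.mem_append.1 hv with hv | hv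
      · exact hsat s hs s' hs' (fun v hv => hss v (by simp [hv])) v hv
      · exact hsat' s hs s' hs' (fun v hv => hss v (by simp [hv])) v hv
    | _ => simp [DepAtom.map] at hτ'
  | _ => simp [DepAtom.map] at hτ

theorem derives_of_mem_explicitClosure {V : Type u} {k : ℕ} (hk : Odd k) (hk2 : 2 ≤ k)
    {x : ℕ → V} {σ : DepAtom V} (h : σ ∈ explicitClosure k x) :
    Derives {R : InferenceRule V | R.IsSound ∧ R.arity ≤ k} (cycleAtoms k x) σ := by
  rcases h with (((h | ⟨i, hi, rfl⟩) | ⟨i, hi, rfl⟩) | ⟨j, hj, hjo, rfl⟩) | ⟨y, z, h, rfl⟩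
  · exact .hyp _ h
  · exact derives_of_entails (Nat.zero_le k) ![] (entails_umi_refl _ _) fun i => i.elim0
  · exact derives_of_entails (Nat.zero_le k) ![] (entails_umde_refl _ _) fun i => i.elim0
  · refine derives_of_entails (by omega) ![.umde (x j) (x (cycleSucc k j))]
      (entails_umde_symm ⟨0, rfl⟩) fun i => ?_
    rw [Subsingleton.elim i 0]
    exact .hyp _ (.inr ⟨j, hj, hjo, rfl⟩)
  · induction h with
    | triv y z hz hy =>
      exact derives_of_entails (Nat.zero_le k) ![] (entails_fd_of_subset _ hz) fun i => i.elim0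
    | step y z _ i hi hik ih =>
      refine derives_of_entails hk2 ![.fd y z, .fd [x i] [x (i + 1)]]
        (entails_fd_append ⟨0, rfl⟩ ⟨1, rfl⟩) fun l => ?_
      match l with
      | 0 => exact ih
      | 1 =>
        exact .hyp _ (.inl ⟨i, hik.le, hi, by rw [(cycleSucc_of_even hk hik.le hi).2]; rfl⟩)
    | congr y z y' z' _ hy hz ih =>
      refine derives_of_entails (by omega) ![.fd y z] (entails_fd_congr ⟨0, rfl⟩ hy hz) fun l => ?_
      rw [Subsingleton.elim l 0]
      exact ih

/-! ### Soundness of the cycle rule -/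

section Values

variable {D : Type u} {A : Type v} {X : ProbTeam D A} {a b : D}

open Classical in
theorem ProbTeam.card_image_pair_of_sat_fd (h : X.Sat (.fd [a] [b])) :
    (X.rows.image fun s => (s a, s b)).card = (X.values a).card := by
  have himg : (X.rows.image fun s => (s a, s b)).image Prod.fst = X.values a := by
    rw [Finset.image_image]
    rfl
  rw [← himg]
  refine (Finset.card_image_of_injOn ?_).symm
  intro p hp q hq hpq
  simp only [Finset.coe_image, Set.mem_image, Finset.mem_coe] at hp hq
  obtain ⟨s, hs, rfl⟩ := hp
  obtain ⟨s', hs', rfl⟩ := hq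
  have hab := ProbTeam.sat_fd_iff.1 h s hs s' hs' (by simpa using hpq) b (by simp)
  exact Prod.ext hpq hab

theorem ProbTeam.card_values_le_of_sat_fd (h : X.Sat (.fd [a] [b])) :
    (X.values b).card ≤ (X.values a).card := by
  classical
  rw [← card_image_pair_of_sat_fd h]
  have himg : (X.rows.image fun s => (s a, s b)).image Prod.snd = X.values b := by
    rw [Finset.image_image]
    rfl
  rw [← himg]
  exact Finset.card_image_le

/-- A function between finite sets of the same size that is onto is invertible. -/
theorem ProbTeam.sat_fd_reverse (h : X.Sat (.fd [a] [b]))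
    (hcard : (X.values a).card = (X.values b).card) : X.Sat (.fd [b] [a]) := by
  classical
  have himg : (X.rows.image fun s => (s a, s b)).image Prod.snd = X.values b := by
    rw [Finset.image_image]
    rfl
  have hinj := Finset.card_image_iff.1
    ((congrArg Finset.card himg).trans (hcard.symm.trans (card_image_pair_of_sat_fd h).symm))
  refine sat_fd_iff.2 fun s hs s' hs' hss v hv => ?_
  obtain rfl : v = a := by simpa using hv
  have := hinj (Finset.mem_coe.2 (Finset.mem_image_of_mem _ hs))
    (Finset.mem_coe.2 (Finset.mem_image_of_mem _ hs')) (hss b (by simp))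
  exact congrArg Prod.fst this

end Values

/-- Along the cycle the numbers of values can only decrease, so that they are all equal. -/
theorem entails_cycle_reverse {V : Type u} {k : ℕ} (hk : Odd k) (x : ℕ → V) :
    Entails (cycleAtoms k x) (.fd [x 1] [x 0]) := by
  refine entails_of_sat fun D A X σ' hσ' hD hX => ?_
  rw [varsOf_cycleAtoms] at hD
  have hmem : ∀ i ≤ k, x i ∈ D := fun i hi => hD ⟨i, hi, rfl⟩
  let d : ℕ → D := fun i => if h : i ≤ k then ⟨x i, hmem i h⟩ else ⟨x 0, hmem 0 (Nat.zero_le k)⟩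
  have hd : ∀ i ≤ k, (d i).1 = x i := fun i hi => by simp only [d, dif_pos hi]
  have hfd : ∀ i < k, Even i → X.Sat (.fd [d i] [d (i + 1)]) := fun i hi he => by
    refine hX _ (.inl ⟨i, hi.le, he, ?_⟩)
    simp [DepAtom.map, hd i hi.le, hd (i + 1) hi, (cycleSucc_of_even hk hi.le he).2]
  have humde : ∀ j ≤ k, Odd j → X.Sat (.umde (d j) (d (cycleSucc k j))) := fun j hj ho => by
    refine hX _ (.inr ⟨j, hj, ho, ?_⟩)
    simp [DepAtom.map, hd j hj, hd _ (cycleSucc_le k j)]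
  have hstep : ∀ i < k, (X.values (d (i + 1))).card ≤ (X.values (d i)).card := by
    intro i hi
    rcases Nat.even_or_odd i with he | ho
    · exact ProbTeam.card_values_le_of_sat_fd (hfd i hi he)
    · have := humde i hi.le ho
      rw [cycleSucc, if_pos hi] at this
      exact (ProbTeam.card_values_eq_of_sat_umde this).ge
  have hchain : ∀ i, 1 ≤ i → i ≤ k → (X.values (d i)).card ≤ (X.values (d 1)).card := by
    intro i h1
    induction i, h1 using Nat.le_induction with
    | base => exact fun _ => le_rfl
    | succ i _ ih => exact fun hi => (hstep i hi).trans (ih (Nat.le_of_succ_le hi))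
  have hclose := ProbTeam.card_values_eq_of_sat_umde (humde k le_rfl hk)
  rw [cycleSucc, if_neg (lt_irrefl k)] at hclose
  have h1 := hstep 0 hk.pos
  have h2 := hchain k hk.pos le_rfl
  have hrev := ProbTeam.sat_fd_reverse (hfd 0 hk.pos Even.zero) (by simp only [zero_add] at *; omega)
  have : σ' = .fd [d 1] [d 0] := by
    refine DepAtom.map_injective Subtype.val_injective ?_
    rw [hσ']
    simp [DepAtom.map, hd 1 hk.pos, hd 0 (Nat.zero_le k)]
  rwa [this]

/-! ### Incompleteness -/

theorem SoundAxiomatization.isSound {V : Type u} {𝒜 : Set (InferenceRule V)}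
    (h : SoundAxiomatization 𝒜) {R : InferenceRule V} (hR : R ∈ 𝒜) : R.IsSound :=
  fun p hp δ hδ => h (Set.range p.1) δ (finite_varsOf_range p.1)
    (.rule R hR p hp (fun i => .hyp _ (Set.mem_range_self i)) δ hδ)

theorem Derives.mono {V : Type u} {𝒜 ℬ : Set (InferenceRule V)} (h : 𝒜 ⊆ ℬ)
    {Γ : Set (DepAtom V)} {σ : DepAtom V} (hσ : Derives 𝒜 Γ σ) : Derives ℬ Γ σ := by
  induction hσ with
  | hyp σ hσ => exact .hyp σ hσ
  | rule R hR p hp _ σ hσ ih => exact .rule R (h hR) p hp ih σ hσ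

/-- The cycle for an odd number that is at least `k` refutes completeness. -/
theorem not_complete_of_kAry {V : Type u} [Infinite V] {k : ℕ} {𝒜 : Set (InferenceRule V)}
    (hk : KAry k 𝒜) (hs : SoundAxiomatization 𝒜) : ¬ CompleteAxiomatization 𝒜 := by
  intro hc
  have hodd : Odd (2 * k + 1) := odd_two_mul_add_one k
  let x : ℕ → V := Infinite.natEmbedding V
  have hx : Set.InjOn x (Set.Iic (2 * k + 1)) := (Infinite.natEmbedding V).injective.injOn
  have hfin : (varsOf (cycleAtoms (2 * k + 1) x)).Finite := by
    rw [varsOf_cycleAtoms]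
    refine ((Set.finite_Iic (2 * k + 1)).image x).subset ?_
    rintro _ ⟨i, hi, rfl⟩
    exact ⟨i, hi, rfl⟩
  have hder := (hc _ _ hfin (entails_cycle_reverse hodd x)).mono
    (ℬ := {R | R.IsSound ∧ R.arity ≤ 2 * k + 1})
    fun R hR => ⟨hs.isSound hR, (hk R hR).trans (by omega)⟩
  exact not_inCycleClosure_reversed (by omega) hx (inCycleClosure_of_derives hodd hx hder)

theorem mainTheorem2 {V : Type u} [Infinite V] :
    -- for no `k` is there a sound and complete `k`-ary axiomatization
    (∀ (k : ℕ) (𝒜 : Set (InferenceRule V)),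
      KAry k 𝒜 → SoundAxiomatization 𝒜 → ¬ CompleteAxiomatization 𝒜) ∧
    -- there is no finite sound and complete axiomatization
    (∀ 𝒜 : Set (InferenceRule V),
      𝒜.Finite → SoundAxiomatization 𝒜 → ¬ CompleteAxiomatization 𝒜) ∧
    -- the closure of the antecedent of the `k`-cycle rule under `k`-ary implication
    (∀ k : ℕ, Odd k → 3 ≤ k → ∀ x : ℕ → V, Set.InjOn x (Set.Iic k) →
      karyClosure k (cycleAtoms k x) = explicitClosure k x ∧
      DepAtom.fd [x 1] [x 0] ∉ explicitClosure k x ∧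
      Entails (cycleAtoms k x) (DepAtom.fd [x 1] [x 0])) := by
  refine ⟨fun k 𝒜 => not_complete_of_kAry, fun 𝒜 hfin => ?_, fun k hk hk3 x hx => ⟨?_, ?_, ?_⟩⟩
  · obtain ⟨k, hk⟩ := (hfin.image InferenceRule.arity).bddAbove
    exact not_complete_of_kAry fun R hR => hk (Set.mem_image_of_mem _ hR)
  · ext σ
    refine ⟨fun h => (mem_explicitClosure_iff hk).2 ⟨h.1, inCycleClosure_of_derives hk hx h.2⟩,
      fun h => ⟨((mem_explicitClosure_iff hk).1 h).1, ?_⟩⟩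
    exact derives_of_mem_explicitClosure hk (by omega) h
  · exact fun h => not_inCycleClosure_reversed (by omega) hx ((mem_explicitClosure_iff hk).1 h).2
  · exact entails_cycle_reverse hk x
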